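/- Let $H$ be an infinite-dimensional (real or complex, not necessarily separable) Hilbert space and let $\mathcal{B}(H)$ be the space of bounded linear operators on $H$. An operator $T\in\mathcal{B}(H)$ is called a $2$-isometry if $$1-2T^*T+{T^*}^2T^2=0.$$ Then the set of $2$-isometries is dense in $\mathcal{B}(H)$ with respect to the weak operator topology (the coarsest topology for which all maps $T\mapsto\langle Tx,y\rangle$, $x,y\in H$, are continuous). -/

import Mathlib

/-- A bounded operator `T` on a Hilbert space is a 2-isometry if `1 - 2 T*T + (T*)² T² = 0`. -/
def IsTwoIsometry {𝕜 H : Type*} [RCLike 𝕜] [NormedAddCommGroup H] [InnerProductSpace 𝕜 H]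
    [CompleteSpace H] (T : H →L[𝕜] H) : Prop :=
  1 - 2 * (ContinuousLinearMap.adjoint T * T) + ContinuousLinearMap.adjoint T ^ 2 * T ^ 2 = 0

/-!
Given `T` and a finite-dimensional subspace `F` with orthogonal projection `P`, there is a
2-isometry `S` with exactly the same compression to `F`, that is `P * S * P = P * T * P`
(`exists_isTwoIsometry_compression_eq`). Letting `F` run through the spans of finite sets then gives
a net of 2-isometries whose matrix coefficients are eventually equal to those of `T`.

With respect to a decomposition `H = K₁ ⊕ K₂`, every operator matrix `[V, E; 0, 1]` with `V` an
isometry of `K₁` and `V* E = 0` is a 2-isometry: here `S* S = 1 + E* E` (with `E* E` acting on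
`K₂`) and `S* (E* E) S = E* E`, whatever the size of `E`. This is
`two_isometry_identity_of_triangular`. The freedom in `E` serves to reach an arbitrary compression,
once `F` is placed diagonally with respect to `K₁ ⊕ K₂`. As `H` is infinite-dimensional, there is an
isometry `J` of `H` with range orthogonal to `F` (`exists_linearIsometry_mem_orthogonal`). Take
`K₂ = (1 - J) F`, with projection `Q = ½ (1 - J) P (1 - J*)`, and put
`S = J² (1 - Q) + Q + ½ (1 + J) P C P (1 - J*)`. The range of `J²` is orthogonal to both `F` and
`J F`, so the triangular form applies, and the compression of `S` to `F` is
`½ P + ½ P C P`; the choice `C = 2 T - 1` makes this `P T P`.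
-/

open Filter Topology

section Algebra

variable {R : Type*} [Ring R] [StarRing R]

/-- An element `v + q + z` of a star ring, triangular with respect to the projection `q`, with `v`
isometric on the complement of `q`, the identity in the corner of `q`, and an arbitrary
off-diagonal part `z` whose range is orthogonal to that of `v`, satisfies the 2-isometry
identity. -/
theorem two_isometry_identity_of_triangular {v q z : R} (hv : star v * v = 1 - q)
    (hqs : star q = q) (hq : q * q = q) (hvq : star v * q = 0) (hvz : star v * z = 0)
    (hqz : q * z = 0) (hzv : z * v = 0) (hzq : z * q = z) (hzz : z * z = 0) :
    1 - 2 * (star (v + q + z) * (v + q + z)) + star (v + q + z) ^ 2 * (v + q + z) ^ 2 = 0 := by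
  have hqv : q * v = 0 := by simpa [hqs] using congrArg star hvq
  have hzv' : star z * v = 0 := by simpa using congrArg star hvz
  have hzq' : star z * q = 0 := by simpa [hqs] using congrArg star hqz
  have hgram : star (v + q + z) * (v + q + z) = 1 + star z * z := by
    simp only [star_add, hqs, add_mul, mul_add, hv, hq, hvq, hvz, hqv, hqz, hzv', hzq']
    abel
  have hzS : z * (v + q + z) = z := by simp [mul_add, hzv, hzq, hzz]
  have hzS' : star (v + q + z) * star z = star z := by rw [← star_mul, hzS]
  generalize v + q + z = s at *
  have h2 : star s ^ 2 * s ^ 2 = 1 + 2 * (star z * z) := by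
    calc star s ^ 2 * s ^ 2 = star s * (1 + star z * z) * s := by
          rw [← hgram]; simp only [pow_two, mul_assoc]
      _ = star s * s + (star s * star z) * (z * s) := by simp only [mul_add, add_mul, mul_one, mul_assoc]
      _ = 1 + 2 * (star z * z) := by rw [hgram, hzS, hzS', two_mul, add_assoc]
  rw [h2, hgram]
  noncomm_ring

variable {𝕜 : Type*} [RCLike 𝕜] [Algebra 𝕜 R] [StarModule 𝕜 R]

/-- The 2-isometry identity for an isometry `w` and elements `d`, `e` whose ranges are orthogonal
to the range of `w` and to each other. The relation `star d * d = 2 * p` says that `d` is `√2` times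
a partial isometry with initial projection `p`, so that `½ d d*` is a projection. -/
theorem two_isometry_identity_of_orthogonal_ranges {w d e p : R} (c : R) (hp : star p = p)
    (hw : star w * w = 1) (hwd : star w * d = 0) (hwe : star w * e = 0)
    (hde : star d * e = 0) (hdd : star d * d = 2 * p) (hdp : d * p = d) :
    let q := (2⁻¹ : 𝕜) • (d * star d)
    let s := w * (1 - q) + q + (2⁻¹ : 𝕜) • (e * c * star d)
    1 - 2 * (star s * s) + star s ^ 2 * s ^ 2 = 0 := by
  intro q s
  have hdw : star d * w = 0 := by simpa using congrArg star hwd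
  have hqs : star q = q := by simp [q, star_smul]
  have hdq : star d * q = star d := by
    have h : p * star d = star d := by simpa [hp] using congrArg star hdp
    calc star d * q = (2⁻¹ : 𝕜) • (star d * d * star d) := by simp only [q, mul_smul_comm, mul_assoc]
      _ = (2⁻¹ : 𝕜) • ((2 : 𝕜) • star d) := by rw [hdd, mul_assoc, h, two_smul, two_mul]
      _ = star d := by rw [smul_smul, inv_mul_cancel₀ two_ne_zero, one_smul]
  have hq : q * q = q := by
    conv_lhs => rw [show q = (2⁻¹ : 𝕜) • (d * star d) from rfl]
    rw [smul_mul_assoc, mul_assoc, hdq]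
  have hwq : star w * q = 0 := by simp only [q, mul_smul_comm, ← mul_assoc, hwd, zero_mul, smul_zero]
  have hqw : q * w = 0 := by simpa [hqs] using congrArg star hwq
  have hwz : star w * ((2⁻¹ : 𝕜) • (e * c * star d)) = 0 := by
    simp only [mul_smul_comm, ← mul_assoc, hwe, zero_mul, smul_zero]
  have hdz : star d * ((2⁻¹ : 𝕜) • (e * c * star d)) = 0 := by
    simp only [mul_smul_comm, ← mul_assoc, hde, zero_mul, smul_zero]
  have hzw : (2⁻¹ : 𝕜) • (e * c * star d) * w = 0 := by
    rw [smul_mul_assoc, mul_assoc, hdw, mul_zero, smul_zero]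
  apply two_isometry_identity_of_triangular _ hqs hq
  · rw [star_mul, mul_assoc, hwq, mul_zero]
  · rw [star_mul, mul_assoc, hwz, mul_zero]
  · rw [smul_mul_assoc, mul_assoc, hdz, mul_zero, smul_zero]
  · rw [← mul_assoc, hzw, zero_mul]
  · rw [smul_mul_assoc, mul_assoc, hdq]
  · rw [smul_mul_assoc, mul_assoc, hdz, mul_zero, smul_zero]
  · calc star (w * (1 - q)) * (w * (1 - q)) = (1 - q) * (star w * w) * (1 - q) := by
          simp only [star_mul, star_sub, star_one, hqs, mul_assoc]
      _ = 1 - q - q + q * q := by rw [hw]; noncomm_ring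
      _ = 1 - q := by rw [hq]; abel

/-- If a star algebra contains an isometry `j` whose range projection is orthogonal to the
projection `p`, then every corner element `p * t * p` is the compression of an element satisfying
the 2-isometry identity. -/
theorem exists_two_isometry_identity_compression_eq (𝕜 : Type*) [RCLike 𝕜] [Algebra 𝕜 R]
    [StarModule 𝕜 R] {j p : R} (t : R) (hj : star j * j = 1)
    (hp : star p = p) (hpp : p * p = p) (hpj : p * j = 0) :
    ∃ s : R, 1 - 2 * (star s * s) + star s ^ 2 * s ^ 2 = 0 ∧ p * s * p = p * t * p := by
  have hjp : star j * p = 0 := by simpa [hp] using congrArg star hpj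
  have hjj : ∀ x, star j * (j * x) = x := fun x ↦ by rw [← mul_assoc, hj, one_mul]
  have hpj' : ∀ x, p * (j * x) = 0 := fun x ↦ by rw [← mul_assoc, hpj, zero_mul]
  have hpp' : ∀ x, p * (p * x) = p * x := fun x ↦ by rw [← mul_assoc, hpp]
  have key := two_isometry_identity_of_orthogonal_ranges (𝕜 := 𝕜) (w := j * j) (d := (1 - j) * p)
    (e := (1 + j) * p) (p := p) (2 * t - 1) hp
    (by simp only [star_mul, mul_assoc, hjj, hj])
    (by simp only [star_mul, mul_assoc, sub_mul, mul_sub, one_mul, hjj, hjp, mul_zero, sub_zero])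
    (by simp only [star_mul, mul_assoc, add_mul, mul_add, one_mul, hjj, hjp, mul_zero, add_zero])
    (by simp only [star_mul, star_sub, hp, mul_assoc, sub_mul, add_mul, mul_add,
          one_mul, hjj, hjp, hpp, hpj', mul_zero]
        abel)
    (by simp only [star_mul, star_sub, hp, mul_assoc, sub_mul, mul_sub,
          one_mul, hjj, hjp, hpp, hpj', mul_zero, two_mul]
        abel)
    (by rw [mul_assoc, hpp])
  refine ⟨_, key, ?_⟩
  have h1 : p * ((1 - j) * p) = p := by simp [sub_mul, mul_sub, hpp, hpj']
  have h2 : p * ((1 + j) * p) = p := by simp [add_mul, mul_add, hpp, hpj']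
  have h3 : star ((1 - j) * p) * p = p := by simpa [hp] using congrArg star h1
  calc _ = p * (j * (j * ((1 - (2⁻¹ : 𝕜) • ((1 - j) * p * star ((1 - j) * p))) * p)))
        + (2⁻¹ : 𝕜) • ((p * ((1 - j) * p)) * (star ((1 - j) * p) * p))
        + (2⁻¹ : 𝕜) • ((p * ((1 + j) * p)) * (2 * t - 1) * (star ((1 - j) * p) * p)) := by
        simp only [mul_add, add_mul, mul_smul_comm, smul_mul_assoc, mul_assoc]
    _ = (2⁻¹ : 𝕜) • (p + p * (2 * t - 1) * p) := by
        rw [h1, h2, h3, hpj', hpp, zero_add, smul_add]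
    _ = (2⁻¹ : 𝕜) • ((2 : 𝕜) • (p * t * p)) := by
        rw [two_smul, mul_sub, sub_mul, mul_one, hpp, two_mul, mul_add, add_mul]
        abel_nf
    _ = p * t * p := by rw [smul_smul, inv_mul_cancel₀ two_ne_zero, one_smul]

end Algebra

section Hilbert

variable {𝕜 H : Type*} [RCLike 𝕜] [NormedAddCommGroup H] [InnerProductSpace 𝕜 H]

theorem HilbertBasis.finiteDimensional {ι : Type*} [Finite ι] (b : HilbertBasis ι 𝕜 H) :
    FiniteDimensional 𝕜 H := by
  have hfin : FiniteDimensional 𝕜 (Submodule.span 𝕜 (Set.range b)) :=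
    FiniteDimensional.span_of_finite 𝕜 (Set.finite_range b)
  have h := b.dense_span
  rw [(Submodule.closed_of_finiteDimensional _).submodule_topologicalClosure_eq] at h
  rw [h] at hfin
  exact Module.finite_def.mpr ((Submodule.fg_top _).mp (Module.finite_def.mp hfin))

variable [CompleteSpace H]

theorem exists_linearIsometry_mem_orthogonal (hH : ¬ FiniteDimensional 𝕜 H)
    (F : Submodule 𝕜 H) [FiniteDimensional 𝕜 F] :
    ∃ J : H →ₗᵢ[𝕜] H, ∀ x, J x ∈ Fᗮ := by
  -- Removing an orthonormal basis of `F` from a Hilbert basis of `H` does not change the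
  -- cardinality of the latter.
  let u := stdOrthonormalBasis 𝕜 F
  let f : Fin (Module.finrank 𝕜 F) → H := fun i ↦ (u i : H)
  have hf : Orthonormal 𝕜 f := u.orthonormal.comp_linearIsometry F.subtypeₗᵢ
  obtain ⟨w, b, hw, hb⟩ := hf.toSubtypeRange.exists_hilbertBasis_extension
  have hinf : Infinite w := by
    by_contra h
    rw [not_infinite_iff_finite] at h
    exact hH b.finiteDimensional
  let s : Set w := (↑) ⁻¹' Set.range f
  have hs : s.Finite := (Set.finite_range f).preimage Subtype.val_injective.injOn
  obtain ⟨φ⟩ : Nonempty (w ≃ (sᶜ : Set w)) :=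
    Cardinal.eq.mp (Cardinal.mk_compl_of_infinite s
      ((Cardinal.lt_aleph0_iff_set_finite.mpr hs).trans_le (Cardinal.aleph0_le_mk w))).symm
  have ho : Orthonormal 𝕜 (fun i ↦ b (φ i)) :=
    b.orthonormal.comp _ (Subtype.val_injective.comp φ.injective)
  refine ⟨ho.orthogonalFamily.linearIsometry.comp b.repr.toLinearIsometry, fun x ↦ ?_⟩
  have hmem : ∀ i, b (φ i) ∈ Fᗮ := by
    intro i
    rw [Submodule.mem_orthogonal]
    intro g hg
    have hsum := congrArg (F.subtypeₗᵢ) (u.sum_repr ⟨g, hg⟩)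
    simp only [map_sum, map_smul, Submodule.coe_subtypeₗᵢ, Submodule.subtype_apply] at hsum
    rw [← hsum, sum_inner]
    refine Finset.sum_eq_zero fun k _ ↦ ?_
    have hk : (u k : H) = b ⟨f k, hw ⟨k, rfl⟩⟩ := by rw [hb]
    rw [inner_smul_left, hk, b.orthonormal.inner_eq_zero, mul_zero]
    intro h
    exact (φ i).2 ⟨k, congrArg Subtype.val h⟩
  exact F.isClosed_orthogonal.mem_of_tendsto
    (ho.orthogonalFamily.hasSum_linearIsometry (b.repr x)) (Eventually.of_forall fun a ↦
      Submodule.sum_mem _ fun i _ ↦ Submodule.smul_mem _ _ (hmem i))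

theorem exists_isTwoIsometry_compression_eq (hH : ¬ FiniteDimensional 𝕜 H)
    (F : Submodule 𝕜 H) [FiniteDimensional 𝕜 F] (T : H →L[𝕜] H) :
    ∃ S : H →L[𝕜] H, IsTwoIsometry S ∧
      F.starProjection * S * F.starProjection = F.starProjection * T * F.starProjection := by
  obtain ⟨J, hJ⟩ := exists_linearIsometry_mem_orthogonal hH F
  have hP := isStarProjection_starProjection (𝕜 := 𝕜) (U := F)
  exact exists_two_isometry_identity_compression_eq 𝕜 (j := J.toContinuousLinearMap)
    (p := F.starProjection) T J.adjoint_comp_self hP.isSelfAdjoint hP.isIdempotentElem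
    (by ext x; simpa using (Submodule.starProjection_apply_eq_zero_iff F).mpr (hJ x))

end Hilbert

theorem mainTheorem4 {𝕜 H : Type*} [RCLike 𝕜] [NormedAddCommGroup H] [InnerProductSpace 𝕜 H]
    [CompleteSpace H] (hH : ¬ FiniteDimensional 𝕜 H) :
    Dense {T : H →WOT[𝕜] H | IsTwoIsometry T.toCLM} := by
  classical
  intro T
  choose S hS hST using fun A : Finset H ↦
    exists_isTwoIsometry_compression_eq hH (Submodule.span 𝕜 (A : Set H)) T.toCLM
  refine mem_closure_of_tendsto (f := fun A ↦ ContinuousLinearMapWOT.ofCLM (S A)) (b := atTop)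
    ?_ (Eventually.of_forall hS)
  rw [ContinuousLinearMapWOT.tendsto_iff_forall_inner_apply_tendsto]
  intro x y
  refine tendsto_const_nhds.congr' ?_
  filter_upwards [eventually_ge_atTop {x, y}] with A hA
  have hx : (Submodule.span 𝕜 (A : Set H)).starProjection x = x :=
    Submodule.starProjection_eq_self_iff.mpr (Submodule.subset_span (hA (by simp)))
  have hy : (Submodule.span 𝕜 (A : Set H)).starProjection y = y :=
    Submodule.starProjection_eq_self_iff.mpr (Submodule.subset_span (hA (by simp)))
  have h := congrArg (inner 𝕜 y) (DFunLike.congr_fun (hST A) x)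
  simp only [mul_apply_eq_comp, hx,
    ← Submodule.inner_starProjection_left_eq_right, hy] at h
  exact h.symm
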